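/- Let $\mathbb{D}$ be the open unit disk in $\mathbb{C}$ and let $d(z)=1-|z|$ denote the Euclidean distance from $z\in\mathbb{D}$ to $\partial\mathbb{D}$. For $\alpha>0$ and $\beta\in\mathbb{R}$, let $\mathcal{LB}^{\beta}_{\alpha}(\mathbb{D})$ be the space of all analytic functions $f:\mathbb{D}\to\mathbb{C}$ with $$\|f\|_{\mathcal{LB}^{\beta}_{\alpha}}=|f(0)|+\sup_{z\in\mathbb{D}}|f'(z)|\,d(z)^{\alpha}\Big(\log\frac{e}{d(z)}\Big)^{\beta}<\infty,$$ and let $H^{2}(\mathbb{D})$ be the Hardy space of all analytic functions $f:\mathbb{D}\to\mathbb{C}$ with $$\|f\|_{2}=\sup_{0<r<1}\Big(\frac{1}{2\pi}\int_{0}^{2\pi}|f(re^{i\theta})|^{2}\,d\theta\Big)^{1/2}<\infty.$$ Let $\alpha>0$, $\beta\le\alpha$, and let $\phi:\mathbb{D}\to\mathbb{D}$ be analytic. Then the following are equivalent: (1) The composition operator $C_{\phi}:f\mapsto f\circ\phi$ is a bounded operator from $\mathcal{LB}^{\beta}_{\alpha}(\mathbb{D})$ to $H^{2}(\mathbb{D})$;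 that is, $f\circ\phi\in H^{2}(\mathbb{D})$ for every $f\in\mathcal{LB}^{\beta}_{\alpha}(\mathbb{D})$, and there is a constant $C<\infty$ with $\|f\circ\phi\|_{2}\le C\,\|f\|_{\mathcal{LB}^{\beta}_{\alpha}}$ for all such $f$. (2) $$\frac{1}{2\pi}\int_{0}^{2\pi}\int_{0}^{1}\frac{|\phi'(re^{i\theta})|^{2}}{d(\phi(re^{i\theta}))^{2\alpha}}\Big(\log\frac{e}{d(\phi(re^{i\theta}))}\Big)^{-2\beta}(1-r)\,dr\,d\theta<\infty.$$ -/

import Mathlib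

open MeasureTheory Set
open scoped ENNReal NNReal

namespace BlochHardy

/-- The open unit disk. -/
def disk : Set ℂ := Metric.ball 0 1

/-- The Euclidean distance from `z` to the boundary of the unit disk. -/
noncomputable def bdist (z : ℂ) : ℝ := Metric.infDist z (frontier disk)

theorem bdist_eq {z : ℂ} (hz : z ∈ disk) : bdist z = 1 - ‖z‖ := by
  have hz' : ‖z‖ < 1 := by simpa [disk] using hz
  have hfr : frontier disk = Metric.sphere (0 : ℂ) 1 := frontier_ball 0 one_ne_zero
  have hne : (Metric.sphere (0 : ℂ) 1).Nonempty := ⟨1, by simp⟩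
  rw [bdist, hfr]
  apply le_antisymm
  · by_cases h0 : z = 0
    · subst h0
      have h1 : (1 : ℂ) ∈ Metric.sphere (0 : ℂ) 1 := by simp
      simpa using Metric.infDist_le_dist_of_mem (x := (0 : ℂ)) h1
    · have hn : ‖z‖ ≠ 0 := norm_ne_zero_iff.mpr h0
      have hmem : ((‖z‖⁻¹ : ℝ) : ℂ) * z ∈ Metric.sphere (0 : ℂ) 1 := by
        simp [hn]
      refine (Metric.infDist_le_dist_of_mem hmem).trans (le_of_eq ?_)
      have hpos : 0 < ‖z‖ := norm_pos_iff.mpr h0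
      have h1 : 1 ≤ ‖z‖⁻¹ := (one_le_inv₀ hpos).mpr hz'.le
      have e : z - ((‖z‖⁻¹ : ℝ) : ℂ) * z = ((1 - ‖z‖⁻¹ : ℝ) : ℂ) * z := by
        push_cast
        ring
      rw [dist_eq_norm, e, norm_mul, Complex.norm_real, Real.norm_eq_abs,
        abs_of_nonpos (by linarith)]
      field_simp
      ring
  · rw [Metric.le_infDist hne]
    intro y hy
    have hy' : ‖y‖ = 1 := by simpa using hy
    have := norm_sub_norm_le y z
    rw [dist_comm, dist_eq_norm]
    linarith

/-- The Bloch-type weight `d(z)^α (log (e / d(z)))^β`. -/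
noncomputable def weight (α β : ℝ) (z : ℂ) : ℝ :=
  bdist z ^ α * Real.log (Real.exp 1 / bdist z) ^ β

/-- The Bloch-type norm `|f(0)| + sup_{z ∈ 𝔻} |f'(z)| d(z)^α (log (e / d(z)))^β`, possibly `∞`.
For analytic `f` the operator norm of the real Jacobian matrix of `f` at `z` is `|f'(z)|`. -/
noncomputable def blochNorm (α β : ℝ) (f : ℂ → ℂ) : ℝ≥0∞ :=
  ‖f 0‖ₑ + ⨆ z ∈ disk, ENNReal.ofReal (‖deriv f z‖ * weight α β z)

/-- The analytic Bloch-type space of the unit disk. Only the values of `f` on the disk matter. -/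
def blochSpace (α β : ℝ) : Set (ℂ → ℂ) :=
  {f | AnalyticOnNhd ℂ f disk ∧ blochNorm α β f < ∞}

/-- The integral mean `M_p(r, f) = ((1/2π) ∫_0^{2π} |f(r e^{iθ})|^p dθ)^{1/p}`. -/
noncomputable def integralMean (p r : ℝ) (f : ℂ → ℂ) : ℝ≥0∞ :=
  (ENNReal.ofReal (1 / (2 * Real.pi)) *
    ∫⁻ θ in Ioc 0 (2 * Real.pi), ‖f (circleMap 0 r θ)‖ₑ ^ p) ^ (1 / p)

/-- The Hardy norm `sup_{0 < r < 1} M_p(r, f)`, possibly `∞`. -/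
noncomputable def hardyNorm (p : ℝ) (f : ℂ → ℂ) : ℝ≥0∞ :=
  ⨆ r ∈ Ioo (0 : ℝ) 1, integralMean p r f

/-- The Hardy space `H^p` of the unit disk, `0 < p < ∞`. -/
def hardySpace (p : ℝ) : Set (ℂ → ℂ) :=
  {f | AnalyticOnNhd ℂ f disk ∧ hardyNorm p f < ∞}

/-- The composition operator `f ↦ f ∘ φ`. -/
def compOp (φ f : ℂ → ℂ) : ℂ → ℂ := f ∘ φ

/-- The operator `T` is bounded from the Bloch-type space to the Hardy space `H^p`: it maps the
former into the latter, with a bound `‖T f‖ ≤ C ‖f‖`. -/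
def IsBoundedBlochHardy (α β p : ℝ) (T : (ℂ → ℂ) → (ℂ → ℂ)) : Prop :=
  MapsTo T (blochSpace α β) (hardySpace p) ∧
    ∃ C : ℝ≥0, ∀ f ∈ blochSpace α β, hardyNorm p (T f) ≤ C * blochNorm α β f

/-- The integral `(1/2π) ∫_0^{2π} ∫_0^1 |φ'|² d(φ)^{-2α} (log (e / d(φ)))^{-2β} (1 - r) dr dθ`,
with `φ` and `φ'` evaluated at `r e^{iθ}`. -/
noncomputable def compIntegral (α β : ℝ) (φ : ℂ → ℂ) : ℝ≥0∞ :=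
  ENNReal.ofReal (1 / (2 * Real.pi)) *
    ∫⁻ θ in Ioc 0 (2 * Real.pi), ∫⁻ r in Ioo (0 : ℝ) 1,
      ENNReal.ofReal
        (‖deriv φ (circleMap 0 r θ)‖ ^ 2 / bdist (φ (circleMap 0 r θ)) ^ (2 * α) *
          Real.log (Real.exp 1 / bdist (φ (circleMap 0 r θ))) ^ (-(2 * β)) * (1 - r))

end BlochHardy

namespace BlochHardy

/-! By Parseval, `‖g‖₂²` is comparable to `|g 0|²` plus the area integral of `|g'|² (1 - r)`
(Littlewood-Paley). This is applied to `g = f ∘ φ`, where `|g'| = |f'(φ)| |φ'|`.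

Sufficiency: insert `|f'| ≤ ‖f‖ / weight` at `φ(z)`, and bound `f (φ 0)` by the Bloch norm
(`exists_norm_apply_le`).

Necessity: a test function with `|f'|` comparable to `1 / weight` everywhere is not needed; it is
enough that this holds in quadratic mean over rotations. With `u = log (1 / d)`, the reciprocal
weight is `growth u = e^{αu} (1 + u)^{-β}`. Take `f' = ∑ growth (k log 2) z^(2^k - 1)`. At boundary
distance `d = e^{-u}` the terms with `2^k` near `e^u` dominate, so the sum of absolute values is
`O(growth u)` and one single term is at least `c * growth u` (`exists_tsum_lacunary_le`,
`exists_lacunary_term_ge`). By Parseval the mean of `|f'(e^{it} w)|²` over `t` is then at least `c²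
/ weight²`. The rotations of `f` are uniformly bounded in the Bloch norm, so averaging their area
integrals and using Tonelli bounds the integral of the symbol. -/

/-! ### Parseval's identity for absolutely convergent trigonometric series -/

lemma integral_exp_sub_mul_I (n m : ℕ) :
    ∫ θ in Ioc 0 (2 * Real.pi), Complex.exp (((n : ℂ) - m) * Complex.I * (θ : ℝ)) =
      if n = m then ((2 * Real.pi : ℝ) : ℂ) else 0 := by
  rw [← intervalIntegral.integral_of_le (by positivity)]
  split_ifs with h
  · subst h
    simp
  · have hc : ((n : ℂ) - m) * Complex.I ≠ 0 :=
      mul_ne_zero (sub_ne_zero.mpr (by exact_mod_cast h)) Complex.I_ne_zero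
    rw [integral_exp_mul_complex hc]
    have : Complex.exp (((n : ℂ) - m) * Complex.I * ((2 * Real.pi : ℝ) : ℂ)) = 1 := by
      rw [Complex.exp_eq_one_iff]
      exact ⟨(n : ℤ) - m, by push_cast; ring⟩
    rw [this]
    simp

/-- The trigonometric series with coefficients `b`. -/
noncomputable def trigSeries (b : ℕ → ℂ) (θ : ℝ) : ℂ :=
  ∑' n, b n * Complex.exp (n * Complex.I * θ)

lemma norm_exp_nat_mul_I_mul (n : ℕ) (θ : ℝ) : ‖Complex.exp (n * Complex.I * θ)‖ = 1 := by
  rw [show (n : ℂ) * Complex.I * θ = ((n * θ : ℝ) : ℂ) * Complex.I by push_cast; ring]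
  exact Complex.norm_exp_ofReal_mul_I _

lemma continuous_trigSeries {b : ℕ → ℂ} (hb : Summable fun n => ‖b n‖) :
    Continuous (trigSeries b) := by
  refine continuous_tsum (fun n => by fun_prop) hb fun n θ => ?_
  rw [norm_mul, norm_exp_nat_mul_I_mul, mul_one]

/-- Parseval's identity for absolutely convergent trigonometric series. -/
lemma integral_norm_sq_trigSeries {b : ℕ → ℂ} (hb : Summable fun n => ‖b n‖) :
    ∫ θ in Ioc 0 (2 * Real.pi), ‖trigSeries b θ‖ ^ 2 = 2 * Real.pi * ∑' n, ‖b n‖ ^ 2 := by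
  have hb' : Summable fun n => ‖(starRingEnd ℂ) (b n)‖ := by simpa using hb
  set F : ℕ × ℕ → ℝ → ℂ := fun p θ => b p.1 * (starRingEnd ℂ) (b p.2) *
    Complex.exp (((p.1 : ℂ) - p.2) * Complex.I * θ) with hF
  have hFn : ∀ p θ, ‖F p θ‖ = ‖b p.1‖ * ‖b p.2‖ := by
    intro p θ
    rw [hF]
    simp only [norm_mul, RCLike.norm_conj]
    rw [show ((p.1 : ℂ) - p.2) * Complex.I * θ = (((p.1 - p.2 : ℝ) * θ : ℝ) : ℂ) * Complex.I by
      push_cast; ring, Complex.norm_exp_ofReal_mul_I, mul_one]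
  have hsum2 : Summable fun p : ℕ × ℕ => ‖b p.1‖ * ‖b p.2‖ :=
    hb.mul_of_nonneg hb (fun _ => norm_nonneg _) (fun _ => norm_nonneg _)
  have hpt : ∀ θ : ℝ, ((‖trigSeries b θ‖ ^ 2 : ℝ) : ℂ) = ∑' p, F p θ := by
    intro θ
    rw [Complex.ofReal_pow, ← Complex.mul_conj', trigSeries, Complex.conj_tsum,
      tsum_mul_tsum_of_summable_norm]
    · refine tsum_congr fun p => ?_
      rw [hF, map_mul, ← Complex.exp_conj]
      have : Complex.exp (((p.1 : ℂ) - p.2) * Complex.I * θ) =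
          Complex.exp (p.1 * Complex.I * θ) *
            Complex.exp ((starRingEnd ℂ) (p.2 * Complex.I * θ)) := by
        rw [← Complex.exp_add]
        congr 1
        simp
        ring
      simp only [this]
      ring
    · simpa [norm_mul, norm_exp_nat_mul_I_mul] using hb
    · simpa [norm_mul, norm_exp_nat_mul_I_mul] using hb
  have hint : ∀ p, Integrable (F p) (volume.restrict (Ioc 0 (2 * Real.pi))) := by
    intro p
    have : Continuous (F p) := by rw [hF]; fun_prop
    exact (this.integrableOn_Icc).mono_set Ioc_subset_Icc_self
  have hIF : ∀ p, ∫ θ in Ioc 0 (2 * Real.pi), F p θ =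
      b p.1 * (starRingEnd ℂ) (b p.2) * if p.1 = p.2 then ((2 * Real.pi : ℝ) : ℂ) else 0 := by
    intro p
    rw [hF]
    simp only
    rw [integral_const_mul, integral_exp_sub_mul_I]
  have hsI : Summable fun p : ℕ × ℕ =>
      b p.1 * (starRingEnd ℂ) (b p.2) * if p.1 = p.2 then ((2 * Real.pi : ℝ) : ℂ) else 0 := by
    refine Summable.of_norm_bounded (hsum2.mul_right (2 * Real.pi)) fun p => ?_
    rw [norm_mul, norm_mul, RCLike.norm_conj]
    gcongr
    split_ifs
    · rw [Complex.norm_real, Real.norm_of_nonneg (by positivity)]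
    · simp; positivity
  have key : ((∫ θ in Ioc 0 (2 * Real.pi), ‖trigSeries b θ‖ ^ 2 : ℝ) : ℂ) =
      ((2 * Real.pi * ∑' n, ‖b n‖ ^ 2 : ℝ) : ℂ) := by
    rw [← integral_complex_ofReal]
    simp_rw [hpt]
    rw [← integral_tsum_of_summable_integral_norm hint]
    · simp_rw [hIF]
      rw [hsI.tsum_prod]
      push_cast
      rw [← tsum_mul_left]
      refine tsum_congr fun n => ?_
      rw [tsum_eq_single n (fun m hm => by simp [hm.symm])]
      simp only [if_true]
      rw [Complex.mul_conj']
      ring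
    · simp_rw [hFn]
      simp only [integral_const]
      exact hsum2.const_smul _
  exact_mod_cast key

lemma lintegral_enorm_sq_trigSeries {b : ℕ → ℂ} (hb : Summable fun n => ‖b n‖) :
    ENNReal.ofReal (1 / (2 * Real.pi)) *
      ∫⁻ θ in Ioc 0 (2 * Real.pi), ‖trigSeries b θ‖ₑ ^ 2 = ∑' n, ‖b n‖ₑ ^ 2 := by
  have h2 : Summable fun n => ‖b n‖ ^ 2 := by
    have := (hb.mul_of_nonneg hb (fun _ => norm_nonneg _) (fun _ => norm_nonneg _)).comp_injective
      (i := fun n : ℕ => (n, n)) (fun a b h => (Prod.mk.inj h).1)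
    simpa [Function.comp_def, pow_two] using this
  have hE : ∀ z : ℂ, ‖z‖ₑ ^ 2 = ENNReal.ofReal (‖z‖ ^ 2) := fun z => by
    rw [← ofReal_norm, ENNReal.ofReal_pow (norm_nonneg _)]
  simp_rw [hE]
  rw [← ofReal_integral_eq_lintegral_ofReal, integral_norm_sq_trigSeries hb,
    ← ENNReal.ofReal_mul (by positivity), ← ENNReal.ofReal_tsum_of_nonneg (fun _ => by positivity) h2]
  · congr 1
    field_simp
  · have : Continuous fun θ => ‖trigSeries b θ‖ ^ 2 := (continuous_trigSeries hb).norm.pow 2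
    exact (this.integrableOn_Icc).mono_set Ioc_subset_Icc_self
  · exact ae_of_all _ fun _ => by positivity

/-! ### Taylor coefficients, the Hardy norm and the Littlewood-Paley estimates -/

/-- The `n`-th Taylor coefficient at `0`. -/
noncomputable def taylorCoeff (g : ℂ → ℂ) (n : ℕ) : ℂ := iteratedDeriv n g 0 / n.factorial

lemma taylorCoeff_deriv (g : ℂ → ℂ) (n : ℕ) :
    taylorCoeff (deriv g) n = (n + 1) * taylorCoeff g (n + 1) := by
  have h1 : (n.factorial : ℂ) ≠ 0 := by exact_mod_cast n.factorial_ne_zero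
  have h2 : (n : ℂ) + 1 ≠ 0 := by exact_mod_cast n.succ_ne_zero
  rw [taylorCoeff, taylorCoeff, iteratedDeriv_succ', Nat.factorial_succ]
  push_cast
  field_simp

lemma isOpen_disk : IsOpen disk := Metric.isOpen_ball

lemma mem_disk {z : ℂ} : z ∈ disk ↔ ‖z‖ < 1 := by simp [disk]

lemma circleMap_mem_disk {r : ℝ} (h0 : 0 ≤ r) (h1 : r < 1) (θ : ℝ) : circleMap 0 r θ ∈ disk := by
  rw [mem_disk, norm_circleMap_zero, abs_of_nonneg h0]
  exact h1

lemma hasSum_taylorCoeff {g : ℂ → ℂ} (hg : AnalyticOnNhd ℂ g disk) {z : ℂ} (hz : z ∈ disk) :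
    HasSum (fun n => taylorCoeff g n * z ^ n) (g z) := by
  have h := Complex.hasSum_taylorSeries_on_ball (f := g) (c := 0) (r := 1)
    hg.differentiableOn hz
  convert! h using 2 with n
  simp only [sub_zero, smul_eq_mul, taylorCoeff]
  ring

lemma summable_norm_taylorCoeff {g : ℂ → ℂ} (hg : AnalyticOnNhd ℂ g disk) {z : ℂ}
    (hz : z ∈ disk) : Summable fun n => ‖taylorCoeff g n * z ^ n‖ :=
  (hasSum_taylorCoeff hg hz).summable.norm

lemma circleMap_zero_pow (r θ : ℝ) (n : ℕ) :
    circleMap 0 r θ ^ n = (r : ℂ) ^ n * Complex.exp (n * Complex.I * θ) := by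
  rw [circleMap, zero_add, mul_pow, ← Complex.exp_nat_mul]
  ring_nf

lemma apply_circleMap_eq_trigSeries {g : ℂ → ℂ} (hg : AnalyticOnNhd ℂ g disk) {r : ℝ}
    (h0 : 0 ≤ r) (h1 : r < 1) (θ : ℝ) :
    g (circleMap 0 r θ) = trigSeries (fun n => taylorCoeff g n * (r : ℂ) ^ n) θ := by
  rw [trigSeries, ← (hasSum_taylorCoeff hg (circleMap_mem_disk h0 h1 θ)).tsum_eq]
  exact tsum_congr fun n => by rw [circleMap_zero_pow, ← mul_assoc]

lemma lintegral_circle_enorm_sq {g : ℂ → ℂ} (hg : AnalyticOnNhd ℂ g disk) {r : ℝ}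
    (h0 : 0 ≤ r) (h1 : r < 1) :
    ENNReal.ofReal (1 / (2 * Real.pi)) *
      ∫⁻ θ in Ioc 0 (2 * Real.pi), ‖g (circleMap 0 r θ)‖ₑ ^ 2 =
      ∑' n, ‖taylorCoeff g n‖ₑ ^ 2 * ENNReal.ofReal (r ^ (2 * n)) := by
  have hr : (r : ℂ) ∈ disk := by
    rw [mem_disk, Complex.norm_real, Real.norm_of_nonneg h0]; exact h1
  simp_rw [apply_circleMap_eq_trigSeries hg h0 h1]
  rw [lintegral_enorm_sq_trigSeries (summable_norm_taylorCoeff hg hr)]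
  refine tsum_congr fun n => ?_
  rw [enorm_mul, mul_pow, enorm_pow, ← pow_mul, mul_comm n 2, ENNReal.ofReal_pow h0,
    ← ofReal_norm (r : ℂ), Complex.norm_real, Real.norm_of_nonneg h0]

lemma integralMean_two_sq (r : ℝ) (g : ℂ → ℂ) :
    integralMean 2 r g ^ 2 = ENNReal.ofReal (1 / (2 * Real.pi)) *
      ∫⁻ θ in Ioc 0 (2 * Real.pi), ‖g (circleMap 0 r θ)‖ₑ ^ 2 := by
  rw [integralMean, ← ENNReal.rpow_natCast, ← ENNReal.rpow_mul]
  norm_num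

/-- The area integral `(1/2π) ∫_0^{2π} ∫_0^1 |g'(r e^{iθ})|² (1 - r) dr dθ`. -/
noncomputable def areaIntegral (g : ℂ → ℂ) : ℝ≥0∞ :=
  ENNReal.ofReal (1 / (2 * Real.pi)) *
    ∫⁻ θ in Ioc 0 (2 * Real.pi), ∫⁻ r in Ioo (0 : ℝ) 1,
      ‖deriv g (circleMap 0 r θ)‖ₑ ^ 2 * ENNReal.ofReal (1 - r)

lemma lintegral_pow_mul_one_sub (n : ℕ) :
    ∫⁻ r in Ioo (0 : ℝ) 1, ENNReal.ofReal (r ^ (2 * n)) * ENNReal.ofReal (1 - r) =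
      ENNReal.ofReal (1 / ((2 * n + 1) * (2 * n + 2))) := by
  have h1 : ∫⁻ r in Ioo (0 : ℝ) 1, ENNReal.ofReal (r ^ (2 * n)) * ENNReal.ofReal (1 - r) =
      ∫⁻ r in Ioo (0 : ℝ) 1, ENNReal.ofReal (r ^ (2 * n) * (1 - r)) :=
    setLIntegral_congr_fun measurableSet_Ioo fun r hr =>
      (ENNReal.ofReal_mul (pow_nonneg hr.1.le _)).symm
  have hc : Continuous fun r : ℝ => r ^ (2 * n) * (1 - r) := by fun_prop
  rw [h1, ← ofReal_integral_eq_lintegral_ofReal]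
  · congr 1
    rw [← integral_Ioc_eq_integral_Ioo, ← intervalIntegral.integral_of_le zero_le_one]
    have : ∀ r : ℝ, r ^ (2 * n) * (1 - r) = r ^ (2 * n) - r ^ (2 * n + 1) := fun r => by ring
    simp_rw [this]
    rw [intervalIntegral.integral_sub (by simp) (by simp), integral_pow, integral_pow]
    push_cast
    simp only [one_pow, ne_eq, Nat.add_eq_zero_iff, one_ne_zero, and_false, not_false_eq_true,
      zero_pow, sub_zero]
    field_simp
    ring
  · exact hc.integrableOn_Icc.mono_set Ioo_subset_Icc_self
  · exact (ae_restrict_iff' measurableSet_Ioo).mpr (ae_of_all _ fun r hr =>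
      mul_nonneg (pow_nonneg hr.1.le _) (sub_nonneg.mpr hr.2.le))

lemma continuous_circleMap_uncurry : Continuous fun p : ℝ × ℝ => circleMap 0 p.1 p.2 := by
  unfold circleMap
  fun_prop

/-- Integrate in the angle first (Parseval for `g'`), then in `r`, term by term. The factor equals
`(n + 1) / (2 (2n + 1))`, which lies between `1/4` and `1/2`; this is the source of the `4` in
`hardyNorm_le_areaIntegral`. -/
lemma areaIntegral_eq_tsum {g : ℂ → ℂ} (hg : AnalyticOnNhd ℂ g disk) :
    areaIntegral g = ∑' n : ℕ, ‖taylorCoeff g (n + 1)‖ₑ ^ 2 *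
      ENNReal.ofReal ((n + 1) ^ 2 / ((2 * n + 1) * (2 * n + 2))) := by
  have hm : Measurable fun p : ℝ × ℝ =>
      ‖deriv g (circleMap 0 p.2 p.1)‖ₑ ^ 2 * ENNReal.ofReal (1 - p.2) := by
    have h1 : Measurable fun p : ℝ × ℝ => deriv g (circleMap 0 p.2 p.1) :=
      (measurable_deriv g).comp (continuous_circleMap_uncurry.measurable.comp measurable_swap)
    exact (h1.enorm.pow_const 2).mul
      (measurable_const.sub measurable_snd).ennreal_ofReal
  rw [areaIntegral, lintegral_lintegral_swap hm.aemeasurable, ← lintegral_const_mul]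
  · calc ∫⁻ r in Ioo (0 : ℝ) 1, ENNReal.ofReal (1 / (2 * Real.pi)) *
          ∫⁻ θ in Ioc 0 (2 * Real.pi),
            ‖deriv g (circleMap 0 r θ)‖ₑ ^ 2 * ENNReal.ofReal (1 - r)
        = ∫⁻ r in Ioo (0 : ℝ) 1, ∑' n : ℕ, ‖taylorCoeff (deriv g) n‖ₑ ^ 2 *
            (ENNReal.ofReal (r ^ (2 * n)) * ENNReal.ofReal (1 - r)) := by
          refine setLIntegral_congr_fun measurableSet_Ioo fun r hr => ?_
          rw [lintegral_mul_const' _ _ ENNReal.ofReal_ne_top, ← mul_assoc,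
            lintegral_circle_enorm_sq hg.deriv hr.1.le hr.2, ← ENNReal.tsum_mul_right]
          simp_rw [mul_assoc]
      _ = _ := by
          rw [lintegral_tsum]
          · refine tsum_congr fun n => ?_
            rw [lintegral_const_mul _ (by fun_prop), lintegral_pow_mul_one_sub, taylorCoeff_deriv,
              enorm_mul, mul_pow, mul_right_comm, mul_comm]
            congr 1
            rw [← ofReal_norm, ← ENNReal.ofReal_pow (norm_nonneg _),
              ← ENNReal.ofReal_mul (by positivity)]
            congr 1
            have : ‖(n : ℂ) + 1‖ = n + 1 := by
              rw [← Nat.cast_succ, Complex.norm_natCast]; simp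
            rw [this]
            ring
          · intro n
            fun_prop
  · exact hm.lintegral_prod_left'

/-- A finite partial sum is continuous in `r` up to `r = 1`, so the bound by the Hardy norm passes
to the limit before the supremum over finite sets is taken. -/
lemma tsum_taylorCoeff_le_hardyNorm_sq {g : ℂ → ℂ} (hg : AnalyticOnNhd ℂ g disk) :
    ∑' n, ‖taylorCoeff g n‖ₑ ^ 2 ≤ hardyNorm 2 g ^ 2 := by
  rw [ENNReal.tsum_eq_iSup_sum]
  refine iSup_le fun s => ?_
  have hcont : ContinuousWithinAt
      (fun r : ℝ => ∑ n ∈ s, ‖taylorCoeff g n‖ₑ ^ 2 * ENNReal.ofReal (r ^ (2 * n)))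
      (Ioo 0 1) 1 := by
    refine (continuous_finsetSum _ fun n _ => ?_).continuousWithinAt
    refine (ENNReal.continuous_const_mul (by finiteness)).comp
      (ENNReal.continuous_ofReal.comp (by fun_prop))
  have hne : (nhdsWithin (1 : ℝ) (Ioo 0 1)).NeBot := by
    rw [← mem_closure_iff_nhdsWithin_neBot, closure_Ioo zero_ne_one]
    simp
  have := le_of_tendsto hcont (b := hardyNorm 2 g ^ 2) ?_
  · simpa using this
  · filter_upwards [self_mem_nhdsWithin] with r hr
    calc _ ≤ ∑' n, ‖taylorCoeff g n‖ₑ ^ 2 * ENNReal.ofReal (r ^ (2 * n)) :=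
          ENNReal.sum_le_tsum s
      _ = integralMean 2 r g ^ 2 := by
          rw [integralMean_two_sq, lintegral_circle_enorm_sq hg hr.1.le hr.2]
      _ ≤ _ := by
          gcongr
          exact le_iSup₂ (f := fun r (_ : r ∈ Ioo (0 : ℝ) 1) => integralMean 2 r g) r hr

lemma hardyNorm_le_tsum_taylorCoeff {g : ℂ → ℂ} (hg : AnalyticOnNhd ℂ g disk) :
    hardyNorm 2 g ≤ (∑' n, ‖taylorCoeff g n‖ₑ ^ 2) ^ (1 / 2 : ℝ) := by
  refine iSup₂_le fun r hr => ?_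
  rw [one_div, ENNReal.le_rpow_inv_iff (by norm_num), ENNReal.rpow_two,
    integralMean_two_sq, lintegral_circle_enorm_sq hg hr.1.le hr.2]
  refine ENNReal.tsum_le_tsum fun n => ?_
  refine mul_le_of_le_one_right' (ENNReal.ofReal_le_one.mpr (pow_le_one₀ hr.1.le hr.2.le))

/-- One half of the Littlewood-Paley identity. -/
lemma areaIntegral_le_hardyNorm_sq {g : ℂ → ℂ} (hg : AnalyticOnNhd ℂ g disk) :
    areaIntegral g ≤ hardyNorm 2 g ^ 2 := by
  refine le_trans ?_ (tsum_taylorCoeff_le_hardyNorm_sq hg)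
  rw [areaIntegral_eq_tsum hg]
  refine le_trans (ENNReal.tsum_le_tsum fun n => ?_) (ENNReal.tsum_comp_le_tsum_of_injective
    (add_left_injective 1) fun n => ‖taylorCoeff g n‖ₑ ^ 2)
  refine mul_le_of_le_one_right' (ENNReal.ofReal_le_one.mpr ?_)
  have : (0 : ℝ) ≤ n := n.cast_nonneg
  rw [div_le_one (by positivity)]
  nlinarith

/-- The other half of the Littlewood-Paley identity. -/
lemma hardyNorm_le_areaIntegral {g : ℂ → ℂ} (hg : AnalyticOnNhd ℂ g disk) :
    hardyNorm 2 g ≤ (‖g 0‖ₑ ^ 2 + 4 * areaIntegral g) ^ (1 / 2 : ℝ) := by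
  refine (hardyNorm_le_tsum_taylorCoeff hg).trans (ENNReal.rpow_le_rpow ?_ (by norm_num))
  rw [areaIntegral_eq_tsum hg, tsum_eq_zero_add' ENNReal.summable, ← ENNReal.tsum_mul_left]
  refine add_le_add (le_of_eq (by simp [taylorCoeff])) (ENNReal.tsum_le_tsum fun n => ?_)
  rw [mul_left_comm]
  refine le_mul_of_one_le_right' ?_
  have : (0 : ℝ) ≤ n := n.cast_nonneg
  rw [show (4 : ℝ≥0∞) = ENNReal.ofReal 4 by simp, ← ENNReal.ofReal_mul (by norm_num),
    ENNReal.one_le_ofReal, ← mul_div_assoc, le_div_iff₀ (by positivity)]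
  nlinarith

/-! ### The weight in the logarithmic variable -/

/-- The reciprocal of the weight as a function of `u = log (1 / d)`. -/
noncomputable def growth (α β u : ℝ) : ℝ := Real.exp (α * u) * (1 + u) ^ (-β)

lemma growth_pos (α β : ℝ) {u : ℝ} (hu : 0 ≤ u) : 0 < growth α β u := by
  unfold growth
  positivity

/-- The logarithmic boundary distance `log (1 / (1 - |z|))`. -/
noncomputable def logDist (z : ℂ) : ℝ := -Real.log (1 - ‖z‖)

lemma logDist_nonneg {z : ℂ} (hz : z ∈ disk) : 0 ≤ logDist z := by
  have := mem_disk.mp hz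
  exact neg_nonneg.mpr (Real.log_nonpos (by linarith) (by linarith [norm_nonneg z]))

lemma exp_neg_logDist {z : ℂ} (hz : z ∈ disk) : Real.exp (-logDist z) = 1 - ‖z‖ := by
  have := mem_disk.mp hz
  rw [logDist, neg_neg, Real.exp_log (by linarith)]

lemma log_exp_one_div_bdist {z : ℂ} (hz : z ∈ disk) :
    Real.log (Real.exp 1 / bdist z) = 1 + logDist z := by
  have := mem_disk.mp hz
  rw [bdist_eq hz, Real.log_div (Real.exp_ne_zero _) (by linarith), Real.log_exp, logDist]
  ring

lemma weight_eq (α β : ℝ) {z : ℂ} (hz : z ∈ disk) :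
    weight α β z = (growth α β (logDist z))⁻¹ := by
  have h0 := logDist_nonneg hz
  rw [weight, log_exp_one_div_bdist hz, bdist_eq hz, ← exp_neg_logDist hz, growth, mul_inv,
    ← Real.exp_neg, ← Real.rpow_neg (by linarith), neg_neg, ← Real.exp_mul]
  ring_nf

lemma weight_pos (α β : ℝ) {z : ℂ} (hz : z ∈ disk) : 0 < weight α β z := by
  rw [weight_eq α β hz]
  exact inv_pos.mpr (growth_pos α β (logDist_nonneg hz))

/-- Peetre's inequality for the growth function. -/
lemma growth_le_growth_mul (α β : ℝ) {u v : ℝ} (hu : 0 ≤ u) (hv : 0 ≤ v) :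
    growth α β v ≤
      growth α β u * (Real.exp (α * (v - u)) * (1 + |v - u|) ^ |β|) := by
  have hD : 0 ≤ |v - u| := abs_nonneg _
  have h1 : v - u ≤ |v - u| := le_abs_self _
  have h2 : u - v ≤ |v - u| := by rw [abs_sub_comm]; exact le_abs_self _
  have key : (1 + v) ^ (-β) ≤ (1 + u) ^ (-β) * (1 + |v - u|) ^ |β| := by
    -- Both signs reduce to `1 + v ≤ (1 + u) (1 + |v - u|)`, with `u` and `v` exchanged when `β ≥
    -- 0`.
    rcases le_total β 0 with hβ | hβ
    · rw [abs_of_nonpos hβ, ← Real.mul_rpow (by linarith) (by linarith)]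
      refine Real.rpow_le_rpow (by linarith) ?_ (by linarith)
      nlinarith
    · rw [abs_of_nonneg hβ, Real.rpow_neg (by linarith), Real.rpow_neg (by linarith),
        inv_mul_eq_div, le_div_iff₀ (by positivity), inv_mul_le_iff₀ (by positivity),
        ← Real.mul_rpow (by linarith) (by linarith)]
      refine Real.rpow_le_rpow (by linarith) ?_ hβ
      nlinarith
  calc growth α β v = Real.exp (α * u) * Real.exp (α * (v - u)) * (1 + v) ^ (-β) := by
        rw [growth, ← Real.exp_add]; ring_nf
    _ ≤ Real.exp (α * u) * Real.exp (α * (v - u)) *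
          ((1 + u) ^ (-β) * (1 + |v - u|) ^ |β|) := by gcongr
    _ = _ := by rw [growth]; ring

/-! ### Two-sided estimates for the lacunary sum -/

lemma exists_one_add_rpow_le_exp {b δ : ℝ} (hb : 0 ≤ b) (hδ : 0 < δ) :
    ∃ K : ℝ, 0 < K ∧ ∀ y : ℝ, 0 ≤ y → (1 + y) ^ b ≤ K * Real.exp (δ * y) := by
  -- Chosen so that `b * η ≤ δ`; the denominator stays positive at `b = 0`.
  set η := δ / (b + 1) with hη
  have hη0 : 0 < η := by positivity
  have hbη : b * η ≤ δ := by
    rw [hη, ← mul_div_assoc, div_le_iff₀ (by positivity)]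
    nlinarith
  refine ⟨η⁻¹ ^ b * Real.exp δ, by positivity, fun y hy => ?_⟩
  have h1 : 1 + y ≤ η⁻¹ * Real.exp (η * (1 + y)) := by
    rw [le_inv_mul_iff₀ hη0]
    linarith [Real.add_one_le_exp (η * (1 + y))]
  calc (1 + y) ^ b ≤ (η⁻¹ * Real.exp (η * (1 + y))) ^ b :=
        Real.rpow_le_rpow (by linarith) h1 hb
    _ = η⁻¹ ^ b * Real.exp (b * η * (1 + y)) := by
        rw [Real.mul_rpow (by positivity) (by positivity), ← Real.exp_mul]
        ring_nf
    _ ≤ η⁻¹ ^ b * Real.exp (δ * (1 + y)) := by gcongr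
    _ = _ := by rw [mul_assoc, ← Real.exp_add]; ring_nf

/-- Here `x` stands for `k log 2 - u`. For `x ≤ 0` the decay comes from `e^{αx}`, half of which
absorbs the polynomial factor; for `x ≥ 0` it comes from the double exponential. -/
lemma exists_double_exp_le {α b : ℝ} (hα : 0 < α) (hb : 0 ≤ b) :
    ∃ K : ℝ, 0 < K ∧ ∀ x : ℝ,
      Real.exp (α * x) * (1 + |x|) ^ b * Real.exp (-Real.exp x) ≤
        K * Real.exp (-(α / 2) * |x|) := by
  obtain ⟨K, hK, h⟩ := exists_one_add_rpow_le_exp hb (half_pos hα)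
  -- `exp (-e^x) ≤ N! e^{-Nx}`, and a rate of `2α` leaves `α + α/2 - 2α = -α/2`.
  obtain ⟨N, hN⟩ := exists_nat_ge (2 * α)
  have hN1 : (1 : ℝ) ≤ N.factorial := by exact_mod_cast N.factorial_pos
  refine ⟨K * N.factorial, by positivity, fun x => ?_⟩
  rcases le_total x 0 with hx | hx
  · rw [abs_of_nonpos hx]
    calc _ ≤ Real.exp (α * x) * (K * Real.exp (α / 2 * -x)) * 1 := by
          gcongr
          · exact h _ (by linarith)
          · exact Real.exp_le_one_iff.mpr (neg_nonpos.mpr (Real.exp_pos x).le)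
      _ = K * 1 * Real.exp (-(α / 2) * -x) := by
          rw [mul_left_comm, ← Real.exp_add]; ring_nf
      _ ≤ _ := by gcongr
  · rw [abs_of_nonneg hx]
    have h1 : Real.exp (-Real.exp x) ≤ N.factorial * Real.exp (-(2 * α) * x) := by
      have h2 := Real.pow_div_factorial_le_exp (Real.exp x) (Real.exp_pos x).le N
      rw [← Real.exp_nat_mul] at h2
      rw [Real.exp_neg, neg_mul, Real.exp_neg, ← div_eq_mul_inv, inv_le_comm₀ (by positivity)
        (by positivity), inv_div]
      refine le_trans ?_ h2
      gcongr
    calc _ ≤ Real.exp (α * x) * (K * Real.exp (α / 2 * x)) *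
            (N.factorial * Real.exp (-(2 * α) * x)) := by
          gcongr
          exact h _ hx
      _ = K * N.factorial *
            (Real.exp (α * x) * Real.exp (α / 2 * x) * Real.exp (-(2 * α) * x)) := by ring
      _ = _ := by
          rw [← Real.exp_add, ← Real.exp_add]; ring_nf

/-- Uniformity in `u`: shifting the index by `⌊u / L⌋` compares with a fixed two-sided geometric
series over `ℤ`. The factor `e^{δL}` pays for the rounding. -/
lemma exists_tsum_exp_neg_abs_le {δ L : ℝ} (hδ : 0 < δ) (hL : 0 < L) :
    ∃ S : ℝ, ∀ u : ℝ, Summable (fun k : ℕ => Real.exp (-δ * |k * L - u|)) ∧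
      ∑' k : ℕ, Real.exp (-δ * |k * L - u|) ≤ S := by
  set G : ℤ → ℝ := fun n => Real.exp (δ * L) * Real.exp (-(δ * L) * |(n : ℝ)|) with hG
  have hGs : Summable G := by
    refine Summable.mul_left _ ?_
    have hs : Summable fun n : ℕ => Real.exp (n * -(δ * L)) :=
      Real.summable_exp_nat_mul_iff.mpr (by nlinarith)
    refine Summable.of_nat_of_neg ?_ ?_ <;>
    · simp only [Int.cast_natCast, Int.cast_neg, abs_neg, Nat.abs_cast]
      simpa only [mul_comm] using hs
  refine ⟨∑' n, G n, fun u => ?_⟩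
  set m : ℤ := ⌊u / L⌋ with hm
  have h1 : (m : ℝ) * L ≤ u := (le_div_iff₀ hL).mp (Int.floor_le _)
  have h2 : u < (m + 1) * L := (div_lt_iff₀ hL).mp (Int.lt_floor_add_one _)
  have hinj : Function.Injective fun k : ℕ => (k : ℤ) - m := fun a b h => by
    simpa using h
  have hle : ∀ k : ℕ, Real.exp (-δ * |k * L - u|) ≤ G ((k : ℤ) - m) := by
    intro k
    rw [hG]
    simp only
    rw [← Real.exp_add, Real.exp_le_exp]
    have h3 : |(k : ℝ) - m| * L ≤ |k * L - u| + L := by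
      rw [← abs_of_pos hL, ← abs_mul, abs_of_pos hL]
      calc |((k : ℝ) - m) * L| = |(k * L - u) + (u - m * L)| := by ring_nf
        _ ≤ |k * L - u| + |u - m * L| := abs_add_le _ _
        _ ≤ _ := by
            rw [abs_of_nonneg (by linarith : 0 ≤ u - m * L)]
            linarith
    push_cast
    nlinarith
  have hs := Summable.of_nonneg_of_le (fun k => (Real.exp_pos _).le) hle
    (hGs.comp_injective hinj)
  exact ⟨hs, hs.tsum_le_tsum_of_inj _ hinj (fun _ _ => by rw [hG]; positivity) hle hGs⟩

lemma exp_mul_log_two (k : ℕ) : Real.exp (k * Real.log 2) = 2 ^ k := by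
  rw [Real.exp_nat_mul, Real.exp_log two_pos]

/-- From `1 - y ≤ e^{-y}` at `y = e^{-u}`. Having exponent `2^k - 1` instead of `2^k` costs a factor
`e^y ≤ e`. -/
lemma pow_two_pow_le (k : ℕ) {u : ℝ} (hu : 0 ≤ u) :
    (1 - Real.exp (-u)) ^ (2 ^ k - 1) ≤
      Real.exp 1 * Real.exp (-Real.exp (k * Real.log 2 - u)) := by
  have h1 : Real.exp (-u) ≤ 1 := Real.exp_le_one_iff.mpr (by linarith)
  have h2 : 1 - Real.exp (-u) ≤ Real.exp (-Real.exp (-u)) := by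
    linarith [Real.add_one_le_exp (-Real.exp (-u))]
  refine (pow_le_pow_left₀ (by linarith) h2 _).trans ?_
  rw [← Real.exp_nat_mul, ← Real.exp_add, Real.exp_le_exp, sub_eq_add_neg _ u, Real.exp_add,
    exp_mul_log_two, Nat.cast_sub Nat.one_le_two_pow]
  push_cast
  linarith

/-- By Peetre's inequality each term divided by `growth α β u` is bounded by a function of `k log 2
- u` alone, which decays exponentially on both sides. -/
lemma exists_tsum_lacunary_le {α : ℝ} (hα : 0 < α) (β : ℝ) :
    ∃ K : ℝ, ∀ u : ℝ, 0 ≤ u →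
      Summable (fun k : ℕ =>
        growth α β (k * Real.log 2) * (1 - Real.exp (-u)) ^ (2 ^ k - 1)) ∧
      ∑' k : ℕ, growth α β (k * Real.log 2) * (1 - Real.exp (-u)) ^ (2 ^ k - 1) ≤
        K * growth α β u := by
  have hL : 0 < Real.log 2 := Real.log_pos one_lt_two
  obtain ⟨K, hK, hdouble⟩ := exists_double_exp_le hα (abs_nonneg β)
  obtain ⟨S, hS⟩ := exists_tsum_exp_neg_abs_le (half_pos hα) hL
  refine ⟨Real.exp 1 * K * S, fun u hu => ?_⟩
  obtain ⟨hs, hS⟩ := hS u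
  have hg := growth_pos α β hu
  have h1 : 0 ≤ 1 - Real.exp (-u) :=
    sub_nonneg.mpr (Real.exp_le_one_iff.mpr (by linarith))
  have hle : ∀ k : ℕ, growth α β (k * Real.log 2) * (1 - Real.exp (-u)) ^ (2 ^ k - 1) ≤
      Real.exp 1 * K * growth α β u * Real.exp (-(α / 2) * |k * Real.log 2 - u|) := by
    intro k
    have hk : (0 : ℝ) ≤ k * Real.log 2 := by positivity
    set x := k * Real.log 2 - u with hx
    calc _ ≤ growth α β u * (Real.exp (α * x) * (1 + |x|) ^ |β|) *
            (Real.exp 1 * Real.exp (-Real.exp x)) :=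
          mul_le_mul (growth_le_growth_mul α β hu hk) (pow_two_pow_le k hu)
            (pow_nonneg h1 _) (by positivity)
      _ = Real.exp 1 * growth α β u *
            (Real.exp (α * x) * (1 + |x|) ^ |β| * Real.exp (-Real.exp x)) := by ring
      _ ≤ Real.exp 1 * growth α β u * (K * Real.exp (-(α / 2) * |x|)) := 
          mul_le_mul_of_nonneg_left (hdouble x) (by positivity)
      _ = _ := by ring
  have hsum := hs.mul_left (Real.exp 1 * K * growth α β u)
  have hsm := Summable.of_nonneg_of_le (fun k : ℕ => mul_nonneg
    (growth_pos α β (by positivity : (0 : ℝ) ≤ k * Real.log 2)).le (pow_nonneg h1 _)) hle hsum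
  refine ⟨hsm, (hsm.tsum_le_tsum hle hsum).trans ?_⟩
  rw [tsum_mul_left]
  calc _ ≤ Real.exp 1 * K * growth α β u * S := by gcongr
    _ = _ := by ring

/-- The reciprocal of the right side is `(1 + 1/j)^j ≤ e`. Used with `j + 1 = 2^k`. -/
lemma exp_neg_one_le_pow (j : ℕ) : Real.exp (-1) ≤ (1 - 1 / ((j : ℝ) + 1)) ^ j := by
  rcases Nat.eq_zero_or_pos j with rfl | hj
  · simp
  · have hj' : (0 : ℝ) < j := by exact_mod_cast hj
    have h1 : 1 - 1 / ((j : ℝ) + 1) = (1 / (j : ℝ) + 1)⁻¹ := by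
      field_simp
      ring
    rw [h1, inv_pow, Real.exp_neg]
    refine inv_anti₀ (by positivity) ?_
    refine (pow_le_pow_left₀ (by positivity) (Real.add_one_le_exp (1 / (j : ℝ))) j).trans ?_
    rw [← Real.exp_nat_mul, mul_one_div_cancel hj'.ne']

lemma exists_lacunary_term_ge (α β : ℝ) (hα : 0 < α) :
    ∃ c : ℝ, 0 < c ∧ ∀ u : ℝ, 0 ≤ u → ∃ k : ℕ,
      c * growth α β u ≤
        growth α β (k * Real.log 2) * (1 - Real.exp (-u)) ^ (2 ^ k - 1) := by
  have hL : 0 < Real.log 2 := Real.log_pos one_lt_two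
  set M := Real.exp (α * Real.log 2) * (1 + Real.log 2) ^ |β| with hM
  have hM0 : 0 < M := by positivity
  refine ⟨Real.exp (-1) / M, by positivity, fun u hu => ?_⟩
  -- Then `2^k ≤ e^u < 2^(k+1)`: the growth changes by at most the factor `M` between `k log 2` and
  -- `u`, and the power is at least `(1 - 2^{-k})^(2^k - 1) ≥ 1/e`.
  set k := ⌊u / Real.log 2⌋₊ with hk
  have h1 : (k : ℝ) * Real.log 2 ≤ u := (le_div_iff₀ hL).mp (Nat.floor_le (by positivity))
  have h2 : u < (k + 1) * Real.log 2 := (div_lt_iff₀ hL).mp (Nat.lt_floor_add_one _)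
  have hk0 : 0 ≤ (k : ℝ) * Real.log 2 := by positivity
  have h3 : growth α β u ≤ growth α β (k * Real.log 2) * M := by
    refine (growth_le_growth_mul α β hk0 hu).trans ?_
    have hd : u - k * Real.log 2 ≤ Real.log 2 := by linarith
    have := (growth_pos α β hk0).le
    rw [hM, abs_of_nonneg (by linarith : 0 ≤ u - k * Real.log 2)]
    have h5 : (1 + (u - k * Real.log 2)) ^ |β| ≤ (1 + Real.log 2) ^ |β| :=
      Real.rpow_le_rpow (by linarith) (by linarith) (abs_nonneg β)
    gcongr
  have h4 : Real.exp (-1) ≤ (1 - Real.exp (-u)) ^ (2 ^ k - 1) := by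
    refine (exp_neg_one_le_pow (2 ^ k - 1)).trans ?_
    rw [Nat.cast_sub Nat.one_le_two_pow]
    push_cast
    rw [sub_add_cancel, ← exp_mul_log_two, one_div, ← Real.exp_neg]
    refine pow_le_pow_left₀ (sub_nonneg.mpr (Real.exp_le_one_iff.mpr (by linarith))) ?_ _
    have := Real.exp_le_exp.mpr (neg_le_neg h1)
    linarith
  refine ⟨k, ?_⟩
  calc Real.exp (-1) / M * growth α β u
      ≤ Real.exp (-1) / M * (growth α β (k * Real.log 2) * M) := by gcongr
    _ = growth α β (k * Real.log 2) * Real.exp (-1) := by field_simp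
    _ ≤ _ := by
        have := (growth_pos α β hk0).le
        gcongr

/-! ### The lacunary test function -/

/-- The coefficients of the lacunary series `∑ growth (k log 2) z ^ (2 ^ k - 1)`. -/
noncomputable def lacunaryCoeff (α β : ℝ) (n : ℕ) : ℝ :=
  open Classical in
  if n ∈ range (fun k : ℕ => 2 ^ k - 1) then growth α β (Real.log (n + 1)) else 0

lemma injective_two_pow_sub_one : Function.Injective fun k : ℕ => 2 ^ k - 1 := by
  intro a b h
  have ha := Nat.one_le_two_pow (n := a)
  have hb := Nat.one_le_two_pow (n := b)
  simp only at h
  exact Nat.pow_right_injective le_rfl (by simp only; omega)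

lemma lacunaryCoeff_two_pow_sub_one (α β : ℝ) (k : ℕ) :
    lacunaryCoeff α β (2 ^ k - 1) = growth α β (k * Real.log 2) := by
  rw [lacunaryCoeff, if_pos ⟨k, rfl⟩, Nat.cast_sub Nat.one_le_two_pow]
  push_cast
  rw [sub_add_cancel, Real.log_pow]

lemma lacunaryCoeff_nonneg (α β : ℝ) (n : ℕ) : 0 ≤ lacunaryCoeff α β n := by
  rw [lacunaryCoeff]
  split_ifs
  · exact (growth_pos α β (Real.log_nonneg (by linarith [n.cast_nonneg (α := ℝ)]))).le
  · exact le_rfl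

/-- This is `exists_tsum_lacunary_le` at `u = logDist z`, where `1 - e^{-u} = |z|`, reindexed over
all exponents so that Parseval applies. -/
lemma exists_tsum_lacunaryCoeff_le {α : ℝ} (hα : 0 < α) (β : ℝ) :
    ∃ K : ℝ, ∀ z ∈ disk, Summable (fun n => lacunaryCoeff α β n * ‖z‖ ^ n) ∧
      ∑' n, lacunaryCoeff α β n * ‖z‖ ^ n ≤ K * growth α β (logDist z) := by
  obtain ⟨K, hK⟩ := exists_tsum_lacunary_le hα β
  refine ⟨K, fun z hz => ?_⟩
  obtain ⟨hs, ht⟩ := hK (logDist z) (logDist_nonneg hz)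
  rw [exp_neg_logDist hz, sub_sub_cancel] at hs ht
  have hsupp : ∀ n ∉ range (fun k : ℕ => 2 ^ k - 1), lacunaryCoeff α β n * ‖z‖ ^ n = 0 :=
    fun n hn => by rw [lacunaryCoeff, if_neg hn, zero_mul]
  have hcomp : ∀ k : ℕ, growth α β (k * Real.log 2) * ‖z‖ ^ (2 ^ k - 1) =
      lacunaryCoeff α β (2 ^ k - 1) * ‖z‖ ^ (2 ^ k - 1) :=
    fun k => by rw [lacunaryCoeff_two_pow_sub_one]
  simp_rw [hcomp] at hs ht
  refine ⟨(injective_two_pow_sub_one.summable_iff hsupp).mp hs, ?_⟩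
  rwa [injective_two_pow_sub_one.tsum_eq
    (f := fun n => lacunaryCoeff α β n * ‖z‖ ^ n)] at ht
  exact fun n hn => by_contra fun h => hn (hsupp n h)

/-- A lacunary series of maximal growth. -/
noncomputable def lacunarySeries (α β : ℝ) (z : ℂ) : ℂ :=
  ∑' n, (lacunaryCoeff α β n : ℂ) * z ^ n

lemma norm_lacunary_term (α β : ℝ) (z : ℂ) (n : ℕ) :
    ‖(lacunaryCoeff α β n : ℂ) * z ^ n‖ = lacunaryCoeff α β n * ‖z‖ ^ n := by
  rw [norm_mul, norm_pow, Complex.norm_real, Real.norm_of_nonneg (lacunaryCoeff_nonneg α β n)]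

lemma differentiableOn_lacunarySeries {α : ℝ} (hα : 0 < α) (β : ℝ) :
    DifferentiableOn ℂ (lacunarySeries α β) disk := by
  obtain ⟨K, hK⟩ := exists_tsum_lacunaryCoeff_le hα β
  intro z hz
  obtain ⟨R, hzR, hR1⟩ := exists_between (mem_disk.mp hz)
  have hR0 : 0 ≤ R := (norm_nonneg z).trans hzR.le
  have hRd : (R : ℂ) ∈ disk := by
    rw [mem_disk, Complex.norm_real, Real.norm_of_nonneg hR0]; exact hR1
  have hs := (hK _ hRd).1
  rw [Complex.norm_real, Real.norm_of_nonneg hR0] at hs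
  have hd : DifferentiableOn ℂ (lacunarySeries α β) (Metric.ball 0 R) := by
    refine Complex.differentiableOn_tsum_of_summable_norm hs (fun n => by fun_prop)
      Metric.isOpen_ball fun n w hw => ?_
    rw [norm_lacunary_term]
    have := lacunaryCoeff_nonneg α β n
    have hw' : ‖w‖ ≤ R := by simpa using (mem_ball_zero_iff.mp hw).le
    gcongr
  exact (hd.differentiableAt (Metric.isOpen_ball.mem_nhds (by simpa using hzR)))
    |>.differentiableWithinAt

/-- A Bloch-type function whose rotations have derivative of maximal growth in quadratic mean. -/
lemma exists_test_function {α : ℝ} (hα : 0 < α) (β : ℝ) :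
    ∃ f : ℂ → ℂ, AnalyticOnNhd ℂ f disk ∧
      (∃ K : ℝ, ∀ z ∈ disk, ‖deriv f z‖ * weight α β z ≤ K) ∧
      ∃ c : ℝ, 0 < c ∧ ∀ z ∈ disk, ENNReal.ofReal (c / weight α β z ^ 2) ≤
        ENNReal.ofReal (1 / (2 * Real.pi)) *
          ∫⁻ t in Ioc 0 (2 * Real.pi), ‖deriv f (circleMap 0 1 t * z)‖ₑ ^ 2 := by
  obtain ⟨K, hK⟩ := exists_tsum_lacunaryCoeff_le hα β
  obtain ⟨c, hc, hlow⟩ := exists_lacunary_term_ge α β hα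
  -- The test function is a primitive of the lacunary series on the disk.
  obtain ⟨f, hf⟩ := (differentiableOn_lacunarySeries hα β).isExactOn_ball
  have hf' : ∀ z ∈ disk, HasDerivAt f (lacunarySeries α β z) z := hf
  refine ⟨f, ?_, ⟨K, fun z hz => ?_⟩, c ^ 2, by positivity, fun z hz => ?_⟩
  · exact DifferentiableOn.analyticOnNhd
      (fun z hz => (hf' z hz).differentiableAt.differentiableWithinAt) isOpen_disk
  · have hg := growth_pos α β (logDist_nonneg hz)
    rw [(hf' z hz).deriv, weight_eq α β hz, ← div_eq_mul_inv, div_le_iff₀ hg]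
    refine (norm_tsum_le_tsum_norm ?_).trans ?_ <;> simp_rw [norm_lacunary_term]
    · exact (hK z hz).1
    · exact (hK z hz).2
  · set b : ℕ → ℂ := fun n => (lacunaryCoeff α β n : ℂ) * z ^ n with hb
    have hbs : Summable fun n => ‖b n‖ := by
      simp_rw [hb, norm_lacunary_term]
      exact (hK z hz).1
    -- For fixed `z`, rotation turns `f'` into a trigonometric series in `t`, whose mean square is a
    -- sum of nonnegative terms; a single one of them gives the lower bound.
    have hrot : ∀ t : ℝ, deriv f (circleMap 0 1 t * z) = trigSeries b t := by
      intro t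
      have hm : circleMap 0 1 t * z ∈ disk := by
        rw [mem_disk, norm_mul, norm_circleMap_zero, abs_one, one_mul]
        exact mem_disk.mp hz
      rw [(hf' _ hm).deriv, lacunarySeries, trigSeries]
      refine tsum_congr fun n => ?_
      rw [mul_pow, circleMap_zero_pow, hb]
      simp
      ring
    simp_rw [hrot]
    rw [lintegral_enorm_sq_trigSeries hbs]
    obtain ⟨k, hk⟩ := hlow _ (logDist_nonneg hz)
    rw [exp_neg_logDist hz, sub_sub_cancel, ← lacunaryCoeff_two_pow_sub_one] at hk
    refine le_trans ?_ (ENNReal.le_tsum (2 ^ k - 1))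
    rw [← ofReal_norm, ← ENNReal.ofReal_pow (norm_nonneg _), hb, norm_lacunary_term,
      weight_eq α β hz, inv_pow, div_inv_eq_mul, ← mul_pow]
    have := growth_pos α β (logDist_nonneg hz)
    gcongr

/-! ### Sufficiency of the integral condition -/

lemma compIntegrand_eq (α β : ℝ) {w : ℂ} (hw : w ∈ disk) (y s : ℝ) (hy : 0 ≤ y) :
    ENNReal.ofReal (y ^ 2 / bdist w ^ (2 * α) *
        Real.log (Real.exp 1 / bdist w) ^ (-(2 * β)) * s) =
      ENNReal.ofReal (y / weight α β w) ^ 2 * ENNReal.ofReal s := by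
  have hb : 0 < bdist w := by rw [bdist_eq hw]; linarith [mem_disk.mp hw]
  have hl : 0 < Real.log (Real.exp 1 / bdist w) := by
    rw [log_exp_one_div_bdist hw]; linarith [logDist_nonneg hw]
  have hp := weight_pos α β hw
  rw [← ENNReal.ofReal_pow (by positivity), ← ENNReal.ofReal_mul (by positivity)]
  congr 2
  rw [weight, div_pow, mul_pow, Real.rpow_neg hl.le, mul_comm 2 α, mul_comm 2 β,
    Real.rpow_mul hb.le, Real.rpow_mul hl.le, Real.rpow_two, Real.rpow_two, ← div_eq_mul_inv,
    div_div]

lemma compIntegral_eq (α β : ℝ) {φ : ℂ → ℂ} (hmaps : MapsTo φ disk disk) :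
    compIntegral α β φ = ENNReal.ofReal (1 / (2 * Real.pi)) *
      ∫⁻ θ in Ioc 0 (2 * Real.pi), ∫⁻ r in Ioo (0 : ℝ) 1,
        ENNReal.ofReal (‖deriv φ (circleMap 0 r θ)‖ / weight α β (φ (circleMap 0 r θ))) ^ 2 *
          ENNReal.ofReal (1 - r) := by
  rw [compIntegral]
  congr 1
  refine lintegral_congr fun θ => setLIntegral_congr_fun measurableSet_Ioo fun r hr => ?_
  exact compIntegrand_eq α β (hmaps (circleMap_mem_disk hr.1.le hr.2 θ)) _ _ (norm_nonneg _)

lemma norm_deriv_le_of_mem_blochSpace {α β : ℝ} {f : ℂ → ℂ} (hf : f ∈ blochSpace α β)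
    {w : ℂ} (hw : w ∈ disk) :
    ‖deriv f w‖ ≤ (blochNorm α β f).toReal * growth α β (logDist w) := by
  have h1 : ENNReal.ofReal (‖deriv f w‖ * weight α β w) ≤ blochNorm α β f :=
    le_add_left (le_iSup₂ (f := fun z (_ : z ∈ disk) =>
      ENNReal.ofReal (‖deriv f z‖ * weight α β z)) w hw)
  have h2 := (ENNReal.ofReal_le_iff_le_toReal hf.2.ne).mp h1
  rwa [weight_eq α β hw, ← div_eq_mul_inv,
    div_le_iff₀ (growth_pos α β (logDist_nonneg hw))] at h2

/-- Controls the constant term `f (φ 0)`, by the mean value inequality on `|z| ≤ |w|`. Since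
`growth` need not be monotone, it is replaced by the monotone majorant with exponent `|β|`. -/
lemma exists_norm_apply_le {α : ℝ} (hα : 0 < α) (β : ℝ) {w : ℂ} (hw : w ∈ disk) :
    ∃ K : ℝ, 0 ≤ K ∧ ∀ f ∈ blochSpace α β, ‖f w‖ ≤ K * (blochNorm α β f).toReal := by
  set U := logDist w with hU
  have hU0 : 0 ≤ U := logDist_nonneg hw
  set M := Real.exp (α * U) * (1 + U) ^ |β| with hM
  have hM0 : 0 < M := by positivity
  refine ⟨1 + M, by positivity, fun f hf => ?_⟩
  set n := (blochNorm α β f).toReal with hn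
  have hn0 : 0 ≤ n := ENNReal.toReal_nonneg
  have hsub : Metric.closedBall (0 : ℂ) ‖w‖ ⊆ disk := fun z hz =>
    mem_disk.mpr ((mem_closedBall_zero_iff.mp hz).trans_lt (mem_disk.mp hw))
  have hder : ∀ z ∈ Metric.closedBall (0 : ℂ) ‖w‖, ‖deriv f z‖ ≤ n * M := by
    intro z hz
    have hzw : ‖z‖ ≤ ‖w‖ := mem_closedBall_zero_iff.mp hz
    have hz0 : 0 ≤ logDist z := logDist_nonneg (hsub hz)
    have hlt := mem_disk.mp hw
    have hle : logDist z ≤ U :=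
      neg_le_neg (Real.log_le_log (by linarith) (by linarith))
    refine (norm_deriv_le_of_mem_blochSpace hf (hsub hz)).trans ?_
    refine mul_le_mul_of_nonneg_left ((growth_le_growth_mul α β le_rfl hz0).trans ?_) hn0
    rw [sub_zero, abs_of_nonneg hz0, hM]
    simp only [growth, mul_zero, Real.exp_zero, add_zero, Real.one_rpow, mul_one, one_mul]
    have : (1 + logDist z) ^ |β| ≤ (1 + U) ^ |β| :=
      Real.rpow_le_rpow (by linarith) (by linarith) (abs_nonneg β)
    gcongr
  have h1 := (convex_closedBall (0 : ℂ) ‖w‖).norm_image_sub_le_of_norm_deriv_le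
    (fun z hz => (hf.1 z (hsub hz)).differentiableAt) hder
    (mem_closedBall_zero_iff.mpr (norm_zero.le.trans (norm_nonneg w))) (mem_closedBall_zero_iff.mpr le_rfl)
  have h0 : ‖f 0‖ ≤ n := by
    rw [← toReal_enorm]
    exact ENNReal.toReal_mono hf.2.ne le_self_add
  have h2 : n * M * ‖w - 0‖ ≤ n * M := by
    rw [sub_zero]
    exact mul_le_of_le_one_right (by positivity) (mem_disk.mp hw).le
  have h3 := norm_sub_norm_le (f w) (f 0)
  linarith

lemma zero_mem_disk : (0 : ℂ) ∈ disk := by simp [mem_disk]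

lemma areaIntegral_comp_le {α β : ℝ} {f φ : ℂ → ℂ} (hf : f ∈ blochSpace α β)
    (hφ : AnalyticOnNhd ℂ φ disk) (hmaps : MapsTo φ disk disk) :
    areaIntegral (f ∘ φ) ≤ blochNorm α β f ^ 2 * compIntegral α β φ := by
  have hN : blochNorm α β f ^ 2 ≠ ∞ := ENNReal.pow_ne_top hf.2.ne
  rw [areaIntegral, compIntegral_eq α β hmaps, mul_left_comm, ← lintegral_const_mul' _ _ hN]
  gcongr with θ
  rw [← lintegral_const_mul' _ _ hN]
  refine setLIntegral_mono' measurableSet_Ioo fun r hr => ?_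
  have hz := circleMap_mem_disk hr.1.le hr.2 θ
  set z := circleMap 0 r θ
  rw [← mul_assoc, ← mul_pow]
  gcongr
  rw [deriv_comp _ (hf.1 _ (hmaps hz)).differentiableAt (hφ z hz).differentiableAt,
    ← ENNReal.ofReal_toReal hf.2.ne, ← ENNReal.ofReal_mul ENNReal.toReal_nonneg, ← ofReal_norm,
    norm_mul, weight_eq α β (hmaps hz), div_inv_eq_mul]
  refine ENNReal.ofReal_le_ofReal ?_
  calc _ ≤ (blochNorm α β f).toReal * growth α β (logDist (φ z)) * ‖deriv φ z‖ := by
        gcongr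
        exact norm_deriv_le_of_mem_blochSpace hf (hmaps hz)
    _ = _ := by ring

lemma isBoundedBlochHardy_of_compIntegral_lt_top {α β : ℝ} (hα : 0 < α) {φ : ℂ → ℂ}
    (hφ : AnalyticOnNhd ℂ φ disk) (hmaps : MapsTo φ disk disk)
    (hI : compIntegral α β φ < ⊤) : IsBoundedBlochHardy α β 2 (compOp φ) := by
  obtain ⟨K, hK0, hK⟩ := exists_norm_apply_le hα β (hmaps zero_mem_disk)
  -- `K²` covers `|f (φ 0)|²`; the `4` is the Littlewood-Paley constant.
  set X : ℝ≥0∞ := ENNReal.ofReal K ^ 2 + 4 * compIntegral α β φ with hX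
  have hXtop : X ^ (1 / 2 : ℝ) ≠ ∞ :=
    ENNReal.rpow_ne_top_of_nonneg (by norm_num) (by rw [hX]; finiteness)
  have main : ∀ f ∈ blochSpace α β,
      hardyNorm 2 (compOp φ f) ≤ (X ^ (1 / 2 : ℝ)).toNNReal * blochNorm α β f := by
    intro f hf
    rw [ENNReal.coe_toNNReal hXtop]
    refine (hardyNorm_le_areaIntegral (hf.1.comp hφ hmaps)).trans ?_
    have h0 : ‖(f ∘ φ) 0‖ₑ ≤ ENNReal.ofReal K * blochNorm α β f := by
      rw [← ENNReal.ofReal_toReal hf.2.ne, ← ENNReal.ofReal_mul hK0, ← ofReal_norm]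
      exact ENNReal.ofReal_le_ofReal (hK f hf)
    calc _ ≤ (X * blochNorm α β f ^ 2) ^ (1 / 2 : ℝ) := by
          refine ENNReal.rpow_le_rpow ?_ (by norm_num)
          calc _ ≤ (ENNReal.ofReal K * blochNorm α β f) ^ 2 +
                4 * (blochNorm α β f ^ 2 * compIntegral α β φ) := by
                gcongr
                exact areaIntegral_comp_le hf hφ hmaps
            _ = _ := by rw [hX]; ring
      _ = _ := by
          rw [ENNReal.mul_rpow_of_nonneg _ _ (by norm_num), ← ENNReal.rpow_natCast_mul]
          norm_num
  exact ⟨fun f hf => ⟨hf.1.comp hφ hmaps, (main f hf).trans_lt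
    (ENNReal.mul_lt_top ENNReal.coe_lt_top hf.2)⟩, _, main⟩

/-! ### Necessity by averaging over rotations -/

lemma circleMap_one_mul_mem_disk (t : ℝ) {z : ℂ} (hz : z ∈ disk) :
    circleMap 0 1 t * z ∈ disk := by
  rw [mem_disk, norm_mul, norm_circleMap_zero, abs_one, one_mul]
  exact mem_disk.mp hz

lemma norm_deriv_rotation {f : ℂ → ℂ} (t : ℝ) (z : ℂ) :
    ‖deriv (fun w => f (circleMap 0 1 t * w)) z‖ = ‖deriv f (circleMap 0 1 t * z)‖ := by
  rw [deriv_comp_mul_left]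
  simp

lemma blochNorm_rotation_le (α β : ℝ) {f : ℂ → ℂ} {K : ℝ}
    (hK : ∀ z ∈ disk, ‖deriv f z‖ * weight α β z ≤ K) (t : ℝ) :
    blochNorm α β (fun w => f (circleMap 0 1 t * w)) ≤ ‖f 0‖ₑ + ENNReal.ofReal K := by
  rw [blochNorm, mul_zero]
  gcongr
  refine iSup₂_le fun z hz => ENNReal.ofReal_le_ofReal ?_
  have hm := circleMap_one_mul_mem_disk t hz
  have hw : weight α β z = weight α β (circleMap 0 1 t * z) := by
    rw [weight_eq α β hz, weight_eq α β hm, logDist, logDist, norm_mul, norm_circleMap_zero,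
      abs_one, one_mul]
  rw [norm_deriv_rotation, hw]
  exact hK _ hm

/-- The mean over all rotations of the test function controls the integral of the symbol. -/
lemma compIntegral_le_lintegral_areaIntegral {α β c : ℝ} (hc : 0 < c) {f φ : ℂ → ℂ}
    (hf : AnalyticOnNhd ℂ f disk) (hφ : AnalyticOnNhd ℂ φ disk) (hmaps : MapsTo φ disk disk)
    (hlow : ∀ z ∈ disk, ENNReal.ofReal (c / weight α β z ^ 2) ≤
        ENNReal.ofReal (1 / (2 * Real.pi)) *
          ∫⁻ t in Ioc 0 (2 * Real.pi), ‖deriv f (circleMap 0 1 t * z)‖ₑ ^ 2) :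
    ENNReal.ofReal c * compIntegral α β φ ≤ ENNReal.ofReal (1 / (2 * Real.pi)) *
      ∫⁻ t in Ioc 0 (2 * Real.pi), areaIntegral ((fun w => f (circleMap 0 1 t * w)) ∘ φ) := by
  classical
  -- `φ` is arbitrary off the disk; extending it by zero gives the joint measurability that Tonelli
  -- requires.
  set ψ : ℂ → ℂ := disk.piecewise φ 0 with hψ
  have hψm : Measurable ψ :=
    hφ.continuousOn.measurable_piecewise continuousOn_const isOpen_disk.measurableSet
  have hψe : ∀ z ∈ disk, ψ z = φ z := fun z hz => piecewise_eq_of_mem _ _ _ hz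
  set κ := ENNReal.ofReal (1 / (2 * Real.pi)) with hκ
  have hκt : κ ≠ ∞ := ENNReal.ofReal_ne_top
  set H : ℝ → ℝ × ℝ → ℝ≥0∞ := fun t p =>
    ‖deriv f (circleMap 0 1 t * ψ (circleMap 0 p.2 p.1))‖ₑ ^ 2 *
      (‖deriv φ (circleMap 0 p.2 p.1)‖ₑ ^ 2 * ENNReal.ofReal (1 - p.2)) with hH
  have hcm : Measurable fun p : ℝ × ℝ => circleMap 0 p.2 p.1 :=
    continuous_circleMap_uncurry.measurable.comp measurable_swap
  have hHm : Measurable (Function.uncurry H) := by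
    have h1 : Measurable fun q : ℝ × ℝ × ℝ => circleMap 0 1 q.1 * ψ (circleMap 0 q.2.2 q.2.1) :=
      ((continuous_circleMap 0 1).measurable.comp measurable_fst).mul
        (hψm.comp (hcm.comp measurable_snd))
    have h2 : Measurable fun q : ℝ × ℝ × ℝ => deriv φ (circleMap 0 q.2.2 q.2.1) :=
      (measurable_deriv φ).comp (hcm.comp measurable_snd)
    exact (((measurable_deriv f).comp h1).enorm.pow_const 2).mul
      ((h2.enorm.pow_const 2).mul
        (measurable_const.sub (measurable_snd.comp measurable_snd)).ennreal_ofReal)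
  have harea : ∀ t, areaIntegral ((fun w => f (circleMap 0 1 t * w)) ∘ φ) =
      κ * ∫⁻ p, H t p ∂((volume.restrict (Ioc 0 (2 * Real.pi))).prod
        (volume.restrict (Ioo (0 : ℝ) 1))) := by
    intro t
    rw [lintegral_prod (H t) (hHm.comp measurable_prodMk_left).aemeasurable, areaIntegral]
    congr 1
    refine lintegral_congr fun θ => setLIntegral_congr_fun measurableSet_Ioo fun r hr => ?_
    have hz := circleMap_mem_disk hr.1.le hr.2 θ
    have hd : DifferentiableAt ℂ (fun w => f (circleMap 0 1 t * w)) (φ (circleMap 0 r θ)) :=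
      ((hf _ (circleMap_one_mul_mem_disk t (hmaps hz))).differentiableAt).comp _ (by fun_prop)
    simp only [hH]
    rw [deriv_comp _ hd (hφ _ hz).differentiableAt, hψe _ hz, ← mul_assoc, enorm_mul, mul_pow,
      ← ofReal_norm (deriv _ (φ _)), norm_deriv_rotation, ofReal_norm]
  simp_rw [harea]
  -- Tonelli makes the rotation integral innermost, so that `hlow` applies pointwise at `φ (r
  -- e^{iθ})`.
  rw [lintegral_const_mul' _ _ hκt, lintegral_lintegral_swap hHm.aemeasurable,
    lintegral_prod (fun p => ∫⁻ t in Ioc 0 (2 * Real.pi), H t p)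
      hHm.lintegral_prod_left'.aemeasurable, compIntegral_eq α β hmaps,
    mul_left_comm]
  refine mul_le_mul' le_rfl ?_
  rw [← lintegral_const_mul' _ _ ENNReal.ofReal_ne_top, ← lintegral_const_mul' _ _ hκt]
  refine lintegral_mono fun θ => ?_
  rw [← lintegral_const_mul' _ _ ENNReal.ofReal_ne_top, ← lintegral_const_mul' _ _ hκt]
  refine setLIntegral_mono' measurableSet_Ioo fun r hr => ?_
  have hz := circleMap_mem_disk hr.1.le hr.2 θ
  simp only [hH, hψe _ hz]
  rw [lintegral_mul_const' _ _ (by finiteness), ← mul_assoc, ← mul_assoc, ← mul_assoc]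
  refine mul_le_mul' ?_ le_rfl
  have hw := weight_pos α β (hmaps hz)
  calc _ = ENNReal.ofReal (c / weight α β (φ (circleMap 0 r θ)) ^ 2) *
        ‖deriv φ (circleMap 0 r θ)‖ₑ ^ 2 := by
        rw [← ofReal_norm, ← ENNReal.ofReal_pow (by positivity),
          ← ENNReal.ofReal_pow (by positivity), ← ENNReal.ofReal_mul hc.le,
          ← ENNReal.ofReal_mul (by positivity)]
        congr 1
        ring
    _ ≤ _ := mul_le_mul' (hlow _ (hmaps hz)) le_rfl

lemma compIntegral_lt_top_of_isBoundedBlochHardy {α β : ℝ} (hα : 0 < α) {φ : ℂ → ℂ}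
    (hφ : AnalyticOnNhd ℂ φ disk) (hmaps : MapsTo φ disk disk)
    (hT : IsBoundedBlochHardy α β 2 (compOp φ)) : compIntegral α β φ < ⊤ := by
  obtain ⟨f, hf, ⟨K, hK⟩, c, hc, hlow⟩ := exists_test_function hα β
  obtain ⟨-, C, hC⟩ := hT
  set B : ℝ≥0∞ := ‖f 0‖ₑ + ENNReal.ofReal K with hB
  have hBt : B < ∞ := by rw [hB]; finiteness
  -- The bound does not depend on `t`, so it survives averaging over the circle.
  have harea : ∀ t, areaIntegral ((fun w => f (circleMap 0 1 t * w)) ∘ φ) ≤ (C * B) ^ 2 := by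
    intro t
    have hN := blochNorm_rotation_le α β hK t
    have hrot : AnalyticOnNhd ℂ (fun w => f (circleMap 0 1 t * w)) disk :=
      hf.comp (analyticOnNhd_const.mul analyticOnNhd_id)
        fun z hz => circleMap_one_mul_mem_disk t hz
    refine (areaIntegral_le_hardyNorm_sq (hrot.comp hφ hmaps)).trans ?_
    gcongr
    exact (hC _ ⟨hrot, hN.trans_lt hBt⟩).trans (by gcongr)
  have h := compIntegral_le_lintegral_areaIntegral hc hf hφ hmaps hlow
  have hfin : ENNReal.ofReal c * compIntegral α β φ < ∞ := by
    refine h.trans_lt ?_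
    refine ENNReal.mul_lt_top ENNReal.ofReal_lt_top ((lintegral_mono harea).trans_lt ?_)
    rw [lintegral_const, Measure.restrict_apply_univ, Real.volume_Ioc]
    finiteness
  exact ENNReal.lt_top_of_mul_ne_top_right hfin.ne (ENNReal.ofReal_pos.mpr hc).ne'

end BlochHardy

theorem mainTheorem6 (α β : ℝ) (hα : 0 < α) (hβ : β ≤ α) (φ : ℂ → ℂ)
    (hφ : AnalyticOnNhd ℂ φ BlochHardy.disk)
    (hmaps : Set.MapsTo φ BlochHardy.disk BlochHardy.disk) :
    BlochHardy.IsBoundedBlochHardy α β 2 (BlochHardy.compOp φ) ↔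
      BlochHardy.compIntegral α β φ < ⊤ :=
  ⟨BlochHardy.compIntegral_lt_top_of_isBoundedBlochHardy hα hφ hmaps,
    BlochHardy.isBoundedBlochHardy_of_compIntegral_lt_top hα hφ hmaps⟩
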